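/- Let $P_0$ be a probability measure on $\mathbb{R}^d$ whose support is bounded with $\operatorname{diam}(\operatorname{supp}P_0)\le R<\infty$. Let $(X_t)_{t\ge 0}$ be the forward process $dX_t=-\tfrac12X_t\,dt+\sqrt{C}\,dB_t$ with $C=I_d$ and $X_0\sim P_0$, where $B$ is a standard $d$-dimensional Brownian motion independent of $X_0$. Then for every $t>0$ the law of $X_t$ has a smooth, everywhere positive density $p_t$ with respect to Lebesgue measure. Let $\delta>0$, $A=(1-e^{-\delta})I_d$ and, for $t\ge\delta$, $\bar A_t=Ae^{-(t-\delta)}+C(1-e^{-(t-\delta)})$ (the initial time being $\delta$). Then for all $t\ge\delta$ we have $\bar A_t=(1-e^{-t})I_d$ and $$\sup_{x\in\mathbb{R}^d}\big\|\nabla^2\log p_t(x)+\bar A_t^{-1}\big\|\le 3\Big(\frac{R}{1-e^{-\delta}}\Big)^2e^{-t},$$ where $\|\cdot\|$ is the operator norm. If moreover $\operatorname{supp}P_0$ is contained in the closed ball of radius $R$ around the origin, then also, for all $t\ge\delta$, with the Euclidean norm $|\cdot|$, $$\sup_{x\in\mathbb{R}^d}\big|\nabla\log p_t(x)+\bar A_t^{-1}x\big|\le\frac{R}{1-e^{-\delta}}\,e^{-t/2}.$$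 -/

import Mathlib

open MeasureTheory ProbabilityTheory
open scoped NNReal ENNReal Gradient MatrixOrder

noncomputable section

/-- The space `ℝ^d` with its Euclidean norm. -/
abbrev Rd (d : ℕ) : Type := EuclideanSpace ℝ (Fin d)

/-- A `d`-dimensional standard Brownian motion: the coordinates are mutually independent
one-dimensional standard Brownian motions (started at `0`, with almost surely continuous paths). -/
structure IsBrownianMotion {d : ℕ} {Ω : Type*} [MeasurableSpace Ω]
    (B : ℝ≥0 → Ω → Rd d) (μ : Measure Ω) : Prop where
  coord : ∀ i : Fin d, IsBrownianReal (fun t ω => B t ω i) μ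
  indep : iIndepFun (fun (i : Fin d) (w : Ω) (t : ℝ≥0) => B t w i) μ

/-- `X` solves `dX_t = -(1/2) X_t dt + √C dB_t`, where `B` is a standard Brownian motion
independent of `X_0` and `X_0` has law `P₀`. As the noise is additive, the equation is the pathwise
identity `X_t = X_0 - (1/2) ∫_0^t X_s ds + √C B_t` for all `t ≥ 0`, almost surely. -/
structure IsForwardProcess {d : ℕ} {Ω : Type*} [MeasurableSpace Ω]
    (C : Matrix (Fin d) (Fin d) ℝ) (P₀ : Measure (Rd d))
    (B X : ℝ≥0 → Ω → Rd d) (μ : Measure Ω) : Prop where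
  brownian : IsBrownianMotion B μ
  initial : HasLaw (X 0) P₀ μ
  indep : IndepFun (X 0) (fun (ω : Ω) (t : ℝ≥0) => B t ω) μ
  aemeasurable : ∀ t, AEMeasurable (X t) μ
  continuous_paths : ∀ᵐ ω ∂μ, Continuous (fun t => X t ω)
  equation : ∀ᵐ ω ∂μ, ∀ t : ℝ≥0,
    X t ω = X 0 ω - (1 / 2 : ℝ) • (∫ s in (0 : ℝ)..(t : ℝ), X s.toNNReal ω)
      + Matrix.toEuclideanCLM (𝕜 := ℝ) (CFC.sqrt C) (B t ω)

/-- The support of `P` is bounded, of diameter at most `R`. -/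
def BoundedSupport {d : ℕ} (P : Measure (Rd d)) (R : ℝ) : Prop :=
  Bornology.IsBounded P.support ∧ Metric.diam P.support ≤ R

/-- `p` is an everywhere positive and smooth probability density of `P` with respect to Lebesgue
measure. (There is at most one, because a continuous density is unique.) -/
structure IsSmoothDensity {d : ℕ} (p : Rd d → ℝ) (P : Measure (Rd d)) : Prop where
  smooth : ContDiff ℝ (⊤ : ℕ∞) p
  pos : ∀ x, 0 < p x
  density : P = volume.withDensity (fun x => ENNReal.ofReal (p x))

/-- The matrix `A e^{-s} + C (1 - e^{-s})`, where `s` is the time elapsed since the time at which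
the reference covariance is `A`. -/
def interpCov {d : ℕ} (A C : Matrix (Fin d) (Fin d) ℝ) (s : ℝ) : Matrix (Fin d) (Fin d) ℝ :=
  Real.exp (-s) • A + (1 - Real.exp (-s)) • C

/-- The Hessian of `f` at `x`, the derivative of the gradient, as a linear operator on `ℝ^d`. -/
def hessian {d : ℕ} (f : Rd d → ℝ) (x : Rd d) : Rd d →L[ℝ] Rd d :=
  fderiv ℝ (gradient f) x

/-- The supremum over `x ∈ ℝ^d` of the norm of `f x`, with values in `[0, ∞]`: the Euclidean norm for
vector fields, the operator norm for operator fields. -/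
def supNorm {d : ℕ} {F : Type*} [NormedAddCommGroup F] (f : Rd d → F) : ℝ≥0∞ :=
  ⨆ x, ‖f x‖ₑ

end

/-!
Solving the linear equation pathwise exhibits `exp (t / 2) • X t` as the almost sure limit of
`X 0 + ∑ exp (s / 2) • (B s' - B s)` along subdivisions, so characteristic functions show that `X t`
is distributed as `exp (-t / 2) • X 0` plus an independent Gaussian of covariance
`v = 1 - exp (-t)`. Its density is `exp (-‖x‖² / (2 v))` times the Laplace transform at `v⁻¹ • x` of
a measure equivalent to the law of `exp (-t / 2) • X 0`. Hence `∇ log p + v⁻¹ • x` and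
`∇² log p + v⁻¹` are `v⁻¹` times the mean and `v⁻²` times the covariance of an exponentially tilted
law, and both are controlled by the size of its support.
-/

noncomputable section

open Filter Topology

section ExponentialFamily

variable {E G : Type*} [NormedAddCommGroup E] [InnerProductSpace ℝ E]
  [NormedAddCommGroup G] [NormedSpace ℝ G]

@[fun_prop]
theorem continuous_innerSL_smulRight {X : Type*} [TopologicalSpace X] {f : X → E} {g : X → G}
    (hf : Continuous f) (hg : Continuous g) :
    Continuous fun y => (innerSL ℝ (f y)).smulRight (g y) :=
  ((ContinuousLinearMap.smulRightL ℝ E G).continuous.comp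
    ((innerSL ℝ).continuous.comp hf)).clm_apply hg

theorem hasFDerivAt_exp_inner_smul (x y : E) (c : G) :
    HasFDerivAt (fun z => Real.exp (inner ℝ z y) • c)
      (Real.exp (inner ℝ x y) • (innerSL ℝ y).smulRight c) x := by
  have hinner : HasFDerivAt (fun z => inner ℝ z y) (innerSL ℝ y) x := by
    simpa only [real_inner_comm] using! (innerSL ℝ y).hasFDerivAt (x := x)
  convert! hinner.exp.smul_const c using 1
  ext w
  simp [smul_smul]

variable [MeasurableSpace E]

/-- The integral of `g` against the unnormalized exponential tilt `exp ⟪x, y⟫ Q(dy)`. The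
derivative in `x` of such a function is again of this form, with values in `E →L[ℝ] G`. -/
def laplaceMoment (Q : Measure E) (g : E → G) (x : E) : G :=
  ∫ y, Real.exp (inner ℝ x y) • g y ∂Q

/-- The Laplace transform of `Q`, the partition function of the exponential family
`Q.tilted (inner ℝ x)`. -/
def laplaceTransform (Q : Measure E) : E → ℝ :=
  laplaceMoment Q fun _ => 1

/-- The mean of the member of parameter `x` of the exponential family generated by `Q`. -/
def tiltedMean (Q : Measure E) (x : E) : E :=
  ∫ y, y ∂(Q.tilted (inner ℝ x))

theorem laplaceTransform_eq_integral (Q : Measure E) (x : E) :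
    laplaceTransform Q x = ∫ y, Real.exp (inner ℝ x y) ∂Q := by
  simp [laplaceTransform, laplaceMoment]

theorem integral_tilted_inner (Q : Measure E) (g : E → G) (x : E) :
    ∫ y, g y ∂(Q.tilted (inner ℝ x)) = (laplaceTransform Q x)⁻¹ • laplaceMoment Q g x := by
  simp only [integral_tilted, laplaceMoment, ← laplaceTransform_eq_integral, div_eq_inv_mul,
    mul_smul, integral_smul]

theorem ae_norm_sub_integral_le [CompleteSpace E] {P : Measure E} [IsProbabilityMeasure P] {s : ℝ}
    (hP : Integrable (fun y => y) P) (hs : ∀ᵐ y ∂P, ∀ᵐ y' ∂P, ‖y - y'‖ ≤ s) :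
    ∀ᵐ y ∂P, ‖y - ∫ y', y' ∂P‖ ≤ s := by
  filter_upwards [hs] with y hy
  have h : y - ∫ y', y' ∂P = ∫ y', (y - y') ∂P := by
    rw [integral_sub (integrable_const _) hP]
    simp
  simpa [h] using norm_integral_le_of_norm_le_const hy

theorem integral_innerSL_smulRight_sub_integral [CompleteSpace E] [CompleteSpace G] {P : Measure E}
    [IsProbabilityMeasure P] {g : E → G} (hid : Integrable (fun y => y) P) (hg : Integrable g P)
    (hidg : Integrable (fun y => (innerSL ℝ y).smulRight (g y)) P) :
    ∫ y, (innerSL ℝ (y - ∫ y', y' ∂P)).smulRight (g y - ∫ y', g y' ∂P) ∂P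
      = ∫ y, (innerSL ℝ y).smulRight (g y) ∂P
        - (innerSL ℝ (∫ y, y ∂P)).smulRight (∫ y, g y ∂P) := by
  set m := ∫ y, y ∂P
  set k := ∫ y, g y ∂P
  let L : E →L[ℝ] E →L[ℝ] G := (ContinuousLinearMap.smulRightL ℝ E G).flip k ∘L innerSL ℝ
  let M : G →L[ℝ] E →L[ℝ] G := ContinuousLinearMap.smulRightL ℝ E G (innerSL ℝ m)
  have hexpand (y : E) : (innerSL ℝ (y - m)).smulRight (g y - k)
      = (innerSL ℝ y).smulRight (g y) - M (g y) - L (y - m) := by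
    ext w
    have hM : M (g y) w = inner ℝ m w • g y := rfl
    have hL : L (y - m) w = inner ℝ (y - m) w • k := rfl
    simp only [sub_apply, ContinuousLinearMap.smulRight_apply, innerSL_apply_apply, hM, hL,
      inner_sub_left]
    module
  have hsub : Integrable (fun y => y - m) P := hid.sub (integrable_const m)
  have hM : Integrable (fun y => M (g y)) P := M.integrable_comp hg
  have hL : ∫ y, L (y - m) ∂P = 0 := by
    rw [L.integral_comp_comm hsub, integral_sub hid (integrable_const m)]
    simp [m]
  simp_rw [hexpand]
  have hdiff : Integrable (fun y => (innerSL ℝ y).smulRight (g y) - M (g y)) P := hidg.sub hM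
  rw [integral_sub hdiff (L.integrable_comp hsub), integral_sub hidg hM, hL,
    M.integral_comp_comm hg, sub_zero]
  rfl

variable [BorelSpace E] [FiniteDimensional ℝ E] {Q : Measure E} [IsFiniteMeasure Q] {r s : ℝ}

theorem integrable_of_continuous_of_ae_norm_le (hQ : ∀ᵐ y ∂Q, ‖y‖ ≤ r) {F : Type*}
    [NormedAddCommGroup F] {f : E → F} (hf : Continuous f) : Integrable f Q := by
  obtain ⟨C, hC⟩ := (isCompact_closedBall (0 : E) r).exists_bound_of_continuousOn hf.continuousOn
  refine .of_bound hf.aestronglyMeasurable C ?_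
  filter_upwards [hQ] with y hy using hC y (by simpa using hy)

theorem isProbabilityMeasure_tilted_inner [NeZero Q] (hQ : ∀ᵐ y ∂Q, ‖y‖ ≤ r) (x : E) :
    IsProbabilityMeasure (Q.tilted (inner ℝ x)) :=
  isProbabilityMeasure_tilted (integrable_of_continuous_of_ae_norm_le hQ (by fun_prop))

theorem laplaceTransform_pos [NeZero Q] (hQ : ∀ᵐ y ∂Q, ‖y‖ ≤ r) (x : E) :
    0 < laplaceTransform Q x := by
  rw [laplaceTransform_eq_integral]
  exact integral_exp_pos (integrable_of_continuous_of_ae_norm_le hQ (by fun_prop))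

theorem hasFDerivAt_laplaceMoment (hQ : ∀ᵐ y ∂Q, ‖y‖ ≤ r) {g : E → G} (hg : Continuous g)
    (x : E) :
    HasFDerivAt (laplaceMoment Q g)
      (laplaceMoment Q (fun y => (innerSL ℝ y).smulRight (g y)) x) x := by
  have hg' : Continuous fun y => (innerSL ℝ y).smulRight (g y) := by fun_prop
  obtain ⟨C, hC⟩ := (isCompact_closedBall (0 : E) r).exists_bound_of_continuousOn hg'.continuousOn
  refine hasFDerivAt_integral_of_dominated_of_fderiv_le (s := Metric.ball x 1)
    (F' := fun z y => Real.exp (inner ℝ z y) • (innerSL ℝ y).smulRight (g y))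
    (bound := fun _ => Real.exp ((‖x‖ + 1) * r) * C) (Metric.ball_mem_nhds x one_pos)
    (.of_forall fun z => Continuous.aestronglyMeasurable (by fun_prop))
    (integrable_of_continuous_of_ae_norm_le hQ (by fun_prop))
    (Continuous.aestronglyMeasurable (by fun_prop)) ?_ (integrable_const _)
    (.of_forall fun y z _ => hasFDerivAt_exp_inner_smul z y (g y))
  filter_upwards [hQ] with y hy z hz
  have hz' : ‖z‖ ≤ ‖x‖ + 1 :=
    (norm_le_norm_add_norm_sub' z x).trans (by gcongr; exact (mem_ball_iff_norm.1 hz).le)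
  rw [norm_smul, Real.norm_eq_abs, Real.abs_exp]
  gcongr
  · exact (real_inner_le_norm z y).trans (by gcongr)
  · exact hC y (by simpa using hy)

theorem laplaceMoment_apply {H : Type*} [NormedAddCommGroup H] [NormedSpace ℝ H]
    (hQ : ∀ᵐ y ∂Q, ‖y‖ ≤ r) {L : E → H →L[ℝ] G} (hL : Continuous L) (x : E) (u : H) :
    laplaceMoment Q L x u = laplaceMoment Q (fun y => L y u) x :=
  ContinuousLinearMap.integral_apply (integrable_of_continuous_of_ae_norm_le hQ (by fun_prop)) u

theorem contDiff_laplaceMoment (hQ : ∀ᵐ y ∂Q, ‖y‖ ≤ r) {g : E → G} (hg : Continuous g) :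
    ContDiff ℝ (⊤ : ℕ∞) (laplaceMoment Q g) := by
  rw [contDiff_infty]
  intro n
  induction n generalizing g with
  | zero =>
    exact contDiff_zero.2 (continuous_iff_continuousAt.2 fun x =>
      (hasFDerivAt_laplaceMoment hQ hg x).continuousAt)
  | succ n ih =>
    push_cast
    refine contDiff_succ_iff_fderiv_apply.2 ⟨fun x =>
      (hasFDerivAt_laplaceMoment hQ hg x).differentiableAt, by simp, fun u => ?_⟩
    have hderiv : (fun x => fderiv ℝ (laplaceMoment Q g) x u)
        = laplaceMoment Q fun y => (innerSL ℝ y).smulRight (g y) u := by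
      funext x
      rw [(hasFDerivAt_laplaceMoment hQ hg x).fderiv, laplaceMoment_apply hQ (by fun_prop)]
    rw [hderiv]
    exact ih (by fun_prop)

theorem hasFDerivAt_laplaceTransform [NeZero Q] (hQ : ∀ᵐ y ∂Q, ‖y‖ ≤ r) (x : E) :
    HasFDerivAt (laplaceTransform Q) (laplaceTransform Q x • innerSL ℝ (tiltedMean Q x)) x := by
  convert! hasFDerivAt_laplaceMoment hQ (continuous_const (y := (1 : ℝ))) x using 1
  have hinner : innerSL ℝ (laplaceMoment Q (fun y => y) x)
      = laplaceMoment Q (fun y => innerSL ℝ y) x := by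
    simp only [laplaceMoment, ← map_smul]
    exact ((innerSL ℝ).integral_comp_comm
      (integrable_of_continuous_of_ae_norm_le hQ (by fun_prop))).symm
  rw [tiltedMean, integral_tilted_inner, map_smul,
    smul_inv_smul₀ (laplaceTransform_pos hQ x).ne', hinner]
  congr
  ext
  simp

theorem hasGradientAt_log_laplaceTransform [NeZero Q] (hQ : ∀ᵐ y ∂Q, ‖y‖ ≤ r) (x : E) :
    HasGradientAt (fun z => Real.log (laplaceTransform Q z)) (tiltedMean Q x) x := by
  have hZ := (laplaceTransform_pos hQ x).ne'
  have h := (hasFDerivAt_laplaceTransform hQ x).log hZ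
  rwa [inv_smul_smul₀ hZ] at h

theorem hasFDerivAt_integral_tilted [NeZero Q] [CompleteSpace G] (hQ : ∀ᵐ y ∂Q, ‖y‖ ≤ r)
    {g : E → G} (hg : Continuous g) (x : E) :
    HasFDerivAt (fun z => ∫ y, g y ∂(Q.tilted (inner ℝ z)))
      (∫ y, (innerSL ℝ (y - tiltedMean Q x)).smulRight (g y - ∫ y', g y' ∂(Q.tilted (inner ℝ x)))
        ∂(Q.tilted (inner ℝ x))) x := by
  have hZ := (laplaceTransform_pos hQ x).ne'
  have := isProbabilityMeasure_tilted_inner hQ x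
  have hτ : ∀ᵐ y ∂(Q.tilted (inner ℝ x)), ‖y‖ ≤ r :=
    (tilted_absolutelyContinuous _ _).ae_le hQ
  have hcov := integral_innerSL_smulRight_sub_integral
    (P := Q.tilted (inner ℝ x)) (integrable_of_continuous_of_ae_norm_le hτ continuous_id)
    (integrable_of_continuous_of_ae_norm_le hτ hg)
    (integrable_of_continuous_of_ae_norm_le hτ (by fun_prop))
  simp_rw [tiltedMean, hcov, integral_tilted_inner Q g]
  convert! ((hasDerivAt_inv hZ).comp_hasFDerivAt x (hasFDerivAt_laplaceTransform hQ x)).smul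
    (hasFDerivAt_laplaceMoment hQ hg x) using 1
  rw [integral_tilted_inner Q (fun y => (innerSL ℝ y).smulRight (g y))]
  have hscalar (c : ℝ) :
      (laplaceTransform Q x ^ 2)⁻¹ * laplaceTransform Q x * c = c * (laplaceTransform Q x)⁻¹ := by
    field_simp
  ext w
  simp [tiltedMean, hscalar, smul_smul, sub_eq_add_neg]

theorem norm_tiltedMean_le [NeZero Q] (hQ : ∀ᵐ y ∂Q, ‖y‖ ≤ r) (x : E) : ‖tiltedMean Q x‖ ≤ r := by
  have := isProbabilityMeasure_tilted_inner hQ x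
  simpa [tiltedMean] using norm_integral_le_of_norm_le_const
    ((tilted_absolutelyContinuous Q (inner ℝ x)).ae_le hQ)

theorem differentiable_tiltedMean [NeZero Q] (hQ : ∀ᵐ y ∂Q, ‖y‖ ≤ r) :
    Differentiable ℝ (tiltedMean Q) := fun x =>
  (hasFDerivAt_integral_tilted hQ continuous_id x).differentiableAt

theorem norm_fderiv_tiltedMean_le [NeZero Q] (hQ : ∀ᵐ y ∂Q, ‖y‖ ≤ r)
    (hs : ∀ᵐ y ∂Q, ∀ᵐ y' ∂Q, ‖y - y'‖ ≤ s) (x : E) : ‖fderiv ℝ (tiltedMean Q) x‖ ≤ s ^ 2 := by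
  have := isProbabilityMeasure_tilted_inner hQ x
  have hac : Q.tilted (inner ℝ x) ≪ Q := tilted_absolutelyContinuous _ _
  have hs' := ae_norm_sub_integral_le
    (integrable_of_continuous_of_ae_norm_le (hac.ae_le hQ) continuous_id)
    (Eventually.mono (hac.ae_le hs) fun y hy => hac.ae_le hy)
  have hderiv : HasFDerivAt (tiltedMean Q) _ x := hasFDerivAt_integral_tilted hQ continuous_id x
  rw [hderiv.fderiv]
  refine (norm_integral_le_of_norm_le_const (C := s ^ 2) ?_).trans_eq (by simp)
  filter_upwards [hs'] with y hy
  rw [ContinuousLinearMap.norm_smulRight_apply, innerSL_apply_norm, sq]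
  gcongr
  exacts [(norm_nonneg _).trans hy, hy, hy]

end ExponentialFamily

section GaussianSmoothing

theorem conv_withDensity_eq_withDensity_lintegral {G : Type*} [AddCommGroup G] [MeasurableSpace G]
    [MeasurableAdd₂ G] [MeasurableSub₂ G] {ν : Measure G} [SFinite ν] [ν.IsAddLeftInvariant]
    (P : Measure G) [SFinite P] {f : G → ℝ≥0∞} (hf : Measurable f) :
    P ∗ ν.withDensity f = ν.withDensity fun x => ∫⁻ y, f (x - y) ∂P := by
  refine Measure.ext_of_lintegral _ fun g hg => ?_
  calc ∫⁻ x, g x ∂(P ∗ ν.withDensity f)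
      = ∫⁻ y, ∫⁻ z, f z * g (y + z) ∂ν ∂P := by
        rw [Measure.lintegral_conv hg]
        refine lintegral_congr fun y => ?_
        exact lintegral_withDensity_eq_lintegral_mul _ hf (by fun_prop)
    _ = ∫⁻ y, ∫⁻ x, f (x - y) * g x ∂ν ∂P := by
        refine lintegral_congr fun y => ?_
        simpa using lintegral_add_left_eq_self (μ := ν) (fun x => f (x - y) * g x) y
    _ = ∫⁻ x, (∫⁻ y, f (x - y) ∂P) * g x ∂ν := by
        rw [lintegral_lintegral_swap (by fun_prop)]
        refine lintegral_congr fun x => lintegral_mul_const _ (by fun_prop)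
    _ = ∫⁻ x, g x ∂(ν.withDensity fun x => ∫⁻ y, f (x - y) ∂P) :=
        (lintegral_withDensity_eq_lintegral_mul _
          (Measurable.lintegral_prod_right' (f := fun p : G × G => f (p.1 - p.2)) (by fun_prop))
          hg).symm

variable {E : Type*} [NormedAddCommGroup E] [InnerProductSpace ℝ E]

/-- The density of the centred Gaussian measure on `E` with covariance `v • 1`. -/
def gaussianDensity (v : ℝ) (z : E) : ℝ :=
  ((2 * Real.pi * v) ^ (Module.finrank ℝ E / 2 : ℝ))⁻¹ * Real.exp (-(2 * v)⁻¹ * ‖z‖ ^ 2)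

@[fun_prop]
theorem continuous_gaussianDensity (v : ℝ) : Continuous (gaussianDensity (E := E) v) := by
  unfold gaussianDensity
  fun_prop

theorem gaussianDensity_pos {v : ℝ} (hv : 0 < v) (z : E) : 0 < gaussianDensity v z := by
  unfold gaussianDensity
  positivity

theorem gaussianDensity_le {v : ℝ} (hv : 0 < v) (z : E) :
    gaussianDensity v z ≤ ((2 * Real.pi * v) ^ (Module.finrank ℝ E / 2 : ℝ))⁻¹ := by
  refine mul_le_of_le_one_right (by positivity) (Real.exp_le_one_iff.2 ?_)
  rw [neg_mul]
  exact neg_nonpos.2 (by positivity)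

theorem gaussianDensity_sub {v : ℝ} (hv : 0 < v) (x y : E) :
    gaussianDensity v (x - y)
      = Real.exp (-(2 * v)⁻¹ * ‖x‖ ^ 2)
        * (gaussianDensity v y * Real.exp (inner ℝ (v⁻¹ • x) y)) := by
  have hexp : Real.exp (-(2 * v)⁻¹ * ‖x - y‖ ^ 2) = Real.exp (-(2 * v)⁻¹ * ‖x‖ ^ 2)
      * Real.exp (-(2 * v)⁻¹ * ‖y‖ ^ 2) * Real.exp (inner ℝ (v⁻¹ • x) y) := by
    rw [← Real.exp_add, ← Real.exp_add, norm_sub_sq_real, real_inner_smul_left]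
    congr 1
    field_simp
    ring
  rw [gaussianDensity, gaussianDensity, hexp]
  ring

variable [MeasurableSpace E]

/-- The density of the convolution of `P` with the Gaussian measure of covariance `v • 1`. -/
def gaussianSmoothing (P : Measure E) (v : ℝ) (x : E) : ℝ :=
  ∫ y, gaussianDensity v (x - y) ∂P

/-- The measure generating the exponential family of the posteriors: if `Y` has law `P` and `Z` is
an independent Gaussian vector of covariance `v • 1`, the law of `Y` given `Y + Z = x` is
`(gaussianWeighted P v).tilted (inner ℝ (v⁻¹ • x))`. -/
def gaussianWeighted (P : Measure E) (v : ℝ) : Measure E :=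
  P.withDensity fun y => ENNReal.ofReal (gaussianDensity v y)

theorem gaussianWeighted_absolutelyContinuous (P : Measure E) (v : ℝ) : gaussianWeighted P v ≪ P :=
  withDensity_absolutelyContinuous _ _

variable [BorelSpace E] {v : ℝ}

theorem integrable_gaussianDensity_comp (P : Measure E) [IsFiniteMeasure P] (hv : 0 < v)
    {f : E → E} (hf : Continuous f) : Integrable (fun y => gaussianDensity v (f y)) P := by
  refine .of_bound (Continuous.aestronglyMeasurable (by fun_prop))
    ((2 * Real.pi * v) ^ (Module.finrank ℝ E / 2 : ℝ))⁻¹ (.of_forall fun y => ?_)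
  rw [Real.norm_eq_abs, abs_of_pos (gaussianDensity_pos hv _)]
  exact gaussianDensity_le hv _

theorem isFiniteMeasure_gaussianWeighted (P : Measure E) [IsFiniteMeasure P] (hv : 0 < v) :
    IsFiniteMeasure (gaussianWeighted P v) :=
  isFiniteMeasure_withDensity_ofReal
    (integrable_gaussianDensity_comp P hv continuous_id).hasFiniteIntegral

theorem neZero_gaussianWeighted (P : Measure E) [NeZero P] (hv : 0 < v) :
    NeZero (gaussianWeighted P v) := by
  refine ⟨fun h => ?_⟩
  rw [gaussianWeighted, withDensity_eq_zero_iff (by fun_prop)] at h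
  obtain ⟨y, hy⟩ := h.exists
  exact (gaussianDensity_pos hv y).not_ge (by simpa using hy)

theorem gaussianSmoothing_eq_exp_mul_laplaceTransform (P : Measure E) (hv : 0 < v) (x : E) :
    gaussianSmoothing P v x = Real.exp (-(2 * v)⁻¹ * ‖x‖ ^ 2)
      * laplaceTransform (gaussianWeighted P v) (v⁻¹ • x) := by
  rw [laplaceTransform_eq_integral, gaussianWeighted,
    integral_withDensity_eq_integral_toReal_smul (by fun_prop)
      (.of_forall fun _ => ENNReal.ofReal_lt_top), gaussianSmoothing, ← integral_const_mul]
  simp_rw [gaussianDensity_sub hv, ENNReal.toReal_ofReal (gaussianDensity_pos hv _).le, smul_eq_mul]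

variable [FiniteDimensional ℝ E] {P : Measure E} [IsFiniteMeasure P] {r s : ℝ}

theorem gaussianSmoothing_pos [NeZero P] (hv : 0 < v) (hP : ∀ᵐ y ∂P, ‖y‖ ≤ r) (x : E) :
    0 < gaussianSmoothing P v x := by
  have := isFiniteMeasure_gaussianWeighted P hv
  have := neZero_gaussianWeighted P hv
  rw [gaussianSmoothing_eq_exp_mul_laplaceTransform P hv]
  exact mul_pos (Real.exp_pos _)
    (laplaceTransform_pos ((gaussianWeighted_absolutelyContinuous P v).ae_le hP) _)

theorem contDiff_gaussianSmoothing (hv : 0 < v) (hP : ∀ᵐ y ∂P, ‖y‖ ≤ r) :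
    ContDiff ℝ (⊤ : ℕ∞) (gaussianSmoothing P v) := by
  have := isFiniteMeasure_gaussianWeighted P hv
  have hL : ContDiff ℝ (⊤ : ℕ∞) (laplaceTransform (gaussianWeighted P v)) :=
    contDiff_laplaceMoment ((gaussianWeighted_absolutelyContinuous P v).ae_le hP) continuous_const
  rw [funext (gaussianSmoothing_eq_exp_mul_laplaceTransform P hv)]
  exact (contDiff_const.mul (contDiff_norm_sq ℝ)).exp.mul (hL.comp (contDiff_const_smul _))

-- Tweedie's formula: the score at `x` is `v⁻¹ • (m x - x)`, with `m x` the posterior mean.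
theorem hasGradientAt_log_gaussianSmoothing [NeZero P] (hv : 0 < v) (hP : ∀ᵐ y ∂P, ‖y‖ ≤ r)
    (x : E) :
    HasGradientAt (fun y => Real.log (gaussianSmoothing P v y))
      (v⁻¹ • tiltedMean (gaussianWeighted P v) (v⁻¹ • x) - v⁻¹ • x) x := by
  have := isFiniteMeasure_gaussianWeighted P hv
  have := neZero_gaussianWeighted P hv
  have hQ := (gaussianWeighted_absolutelyContinuous P v).ae_le hP
  have hlog : (fun y => Real.log (gaussianSmoothing P v y)) = fun y =>
      -(2 * v)⁻¹ * ‖y‖ ^ 2 + Real.log (laplaceTransform (gaussianWeighted P v) (v⁻¹ • y)) := by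
    funext y
    rw [gaussianSmoothing_eq_exp_mul_laplaceTransform P hv, Real.log_mul (Real.exp_ne_zero _)
      (laplaceTransform_pos hQ _).ne', Real.log_exp]
  have hquad := (hasStrictFDerivAt_norm_sq x).hasFDerivAt.const_mul (-(2 * v)⁻¹)
  have hlaplace := (hasGradientAt_log_laplaceTransform hQ (v⁻¹ • x)).hasFDerivAt.comp x
    ((hasFDerivAt_id x).const_smul v⁻¹)
  rw [hlog, hasGradientAt_iff_hasFDerivAt]
  convert! hquad.add hlaplace using 1
  ext w
  simp only [map_sub, map_smul, sub_apply, smul_apply, InnerProductSpace.toDual_apply_apply,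
    smul_eq_mul, mul_inv_rev, neg_smul, ContinuousLinearMap.comp_smulₛₗ, map_inv₀,
    Real.ringHom_apply, ContinuousLinearMap.comp_id, add_apply, neg_apply, coe_innerSL_apply,
    nsmul_eq_mul, Nat.cast_ofNat]
  field_simp
  ring

theorem norm_gradient_log_gaussianSmoothing_add_le [NeZero P] (hv : 0 < v)
    (hP : ∀ᵐ y ∂P, ‖y‖ ≤ r) (x : E) :
    ‖gradient (fun y => Real.log (gaussianSmoothing P v y)) x + v⁻¹ • x‖ ≤ v⁻¹ * r := by
  have := isFiniteMeasure_gaussianWeighted P hv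
  have := neZero_gaussianWeighted P hv
  rw [(hasGradientAt_log_gaussianSmoothing hv hP x).gradient, sub_add_cancel, norm_smul,
    Real.norm_of_nonneg (inv_nonneg.2 hv.le)]
  gcongr
  exact norm_tiltedMean_le ((gaussianWeighted_absolutelyContinuous P v).ae_le hP) _

theorem norm_fderiv_gradient_log_gaussianSmoothing_add_le [NeZero P] (hv : 0 < v)
    (hP : ∀ᵐ y ∂P, ‖y‖ ≤ r) (hs : ∀ᵐ y ∂P, ∀ᵐ y' ∂P, ‖y - y'‖ ≤ s) (x : E) :
    ‖fderiv ℝ (gradient fun y => Real.log (gaussianSmoothing P v y)) x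
      + v⁻¹ • ContinuousLinearMap.id ℝ E‖ ≤ (v⁻¹ * s) ^ 2 := by
  have := isFiniteMeasure_gaussianWeighted P hv
  have := neZero_gaussianWeighted P hv
  have hac := gaussianWeighted_absolutelyContinuous P v
  have hQ := hac.ae_le hP
  have hsQ : ∀ᵐ y ∂(gaussianWeighted P v), ∀ᵐ y' ∂(gaussianWeighted P v), ‖y - y'‖ ≤ s :=
    Eventually.mono (hac.ae_le hs) fun y hy => hac.ae_le hy
  have hderiv : HasFDerivAt
      (fun z => v⁻¹ • tiltedMean (gaussianWeighted P v) (v⁻¹ • z) - v⁻¹ • z)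
      (v⁻¹ • v⁻¹ • fderiv ℝ (tiltedMean (gaussianWeighted P v)) (v⁻¹ • x)
        - v⁻¹ • ContinuousLinearMap.id ℝ E) x := by
    have hid := (hasFDerivAt_id (𝕜 := ℝ) x).const_smul v⁻¹
    convert! ((((differentiable_tiltedMean hQ _).hasFDerivAt).comp x hid).const_smul v⁻¹).sub hid
      using 1
    ext w
    simp
  rw [funext fun z => (hasGradientAt_log_gaussianSmoothing hv hP z).gradient, hderiv.fderiv,
    sub_add_cancel, smul_smul, norm_smul, mul_pow, ← sq, Real.norm_of_nonneg (sq_nonneg _)]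
  gcongr
  exact norm_fderiv_tiltedMean_le hQ hsQ _

variable (E) in
/-- The centred Gaussian measure on `E` with covariance `v • 1`. -/
def gaussianMeasure (v : ℝ) : Measure E :=
  volume.withDensity fun z => ENNReal.ofReal (gaussianDensity v z)

theorem charFun_gaussianMeasure (hv : 0 < v) (ξ : E) :
    charFun (gaussianMeasure E v) ξ = Complex.exp (-(v * ‖ξ‖ ^ 2 / 2 : ℝ)) := by
  set c : ℝ := (2 * Real.pi * v) ^ (Module.finrank ℝ E / 2 : ℝ) with hc
  have hc_ne : (c : ℂ) ≠ 0 := by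
    have : 0 < c := by positivity
    exact_mod_cast this.ne'
  have hfourier := GaussianFourier.integral_cexp_neg_mul_sq_norm_add (V := E)
    (b := ((2 * v)⁻¹ : ℝ)) (by rw [Complex.ofReal_re]; positivity) Complex.I ξ
  have hconst : (Real.pi / (((2 * v)⁻¹ : ℝ) : ℂ)) ^ (Module.finrank ℝ E / 2 : ℂ) = c := by
    rw [hc, Complex.ofReal_cpow (by positivity)]
    push_cast
    rw [div_inv_eq_mul]
    ring_nf
  have hintegrand (z : E) : (ENNReal.ofReal (gaussianDensity v z)).toReal
      • Complex.exp (inner ℝ z ξ * Complex.I)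
      = (c : ℂ)⁻¹ * Complex.exp (-(((2 * v)⁻¹ : ℝ) : ℂ) * ‖z‖ ^ 2 + Complex.I * inner ℝ ξ z) := by
    rw [ENNReal.toReal_ofReal (gaussianDensity_pos hv z).le, gaussianDensity, Complex.exp_add,
      Complex.real_smul, real_inner_comm z ξ, ← hc]
    push_cast
    ring_nf
  have hexp : Complex.I ^ 2 * ‖ξ‖ ^ 2 / (4 * (((2 * v)⁻¹ : ℝ) : ℂ)) = (-(v * ‖ξ‖ ^ 2 / 2) : ℝ) := by
    have : (v : ℂ) ≠ 0 := by exact_mod_cast hv.ne'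
    push_cast
    rw [Complex.I_sq]
    field_simp
    ring
  rw [charFun_apply, gaussianMeasure, integral_withDensity_eq_integral_toReal_smul (by fun_prop)
    (.of_forall fun _ => ENNReal.ofReal_lt_top)]
  simp_rw [hintegrand]
  rw [integral_const_mul, hfourier, hconst, hexp, inv_mul_cancel_left₀ hc_ne, Complex.ofReal_neg]

theorem isProbabilityMeasure_gaussianMeasure (hv : 0 < v) :
    IsProbabilityMeasure (gaussianMeasure E v) := by
  have hreal : (gaussianMeasure E v).real Set.univ = 1 := by
    have h := charFun_gaussianMeasure hv (0 : E)
    rw [charFun_zero] at h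
    simpa using h
  exact ⟨(ENNReal.toReal_eq_one_iff _).1 hreal⟩

theorem conv_gaussianMeasure (P : Measure E) [IsFiniteMeasure P] (hv : 0 < v) :
    P ∗ gaussianMeasure E v
      = volume.withDensity fun x => ENNReal.ofReal (gaussianSmoothing P v x) := by
  rw [gaussianMeasure, conv_withDensity_eq_withDensity_lintegral P (by fun_prop)]
  congr with x
  exact (ofReal_integral_eq_lintegral_ofReal (integrable_gaussianDensity_comp P hv (by fun_prop))
    (.of_forall fun y => (gaussianDensity_pos hv _).le)).symm

end GaussianSmoothing

section ExponentialRiemannSum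

/-- The `k`-th point of the regular subdivision of `[0, t]` into `n` intervals. -/
def gridPoint (t : ℝ≥0) (n k : ℕ) : ℝ≥0 := k * (t / n)

theorem gridPoint_mono (t : ℝ≥0) (n : ℕ) : Monotone (gridPoint t n) := fun i j h => by
  unfold gridPoint
  gcongr

@[simp]
theorem gridPoint_zero (t : ℝ≥0) (n : ℕ) : gridPoint t n 0 = 0 := by
  simp [gridPoint]

theorem gridPoint_self (t : ℝ≥0) {n : ℕ} (hn : n ≠ 0) : gridPoint t n n = t := by
  unfold gridPoint
  field_simp

theorem coe_gridPoint_succ_sub (t : ℝ≥0) (n k : ℕ) :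
    (gridPoint t n (k + 1) - gridPoint t n k : ℝ) = t / n := by
  simp only [gridPoint]
  push_cast
  ring

variable {E : Type*} [NormedAddCommGroup E] {t : ℝ≥0}

theorem tendsto_sum_gridPoint_zero {f : ℝ≥0 → ℝ≥0 → E}
    (hf : ∀ ε > 0, ∃ δ > 0, ∀ r s : ℝ≥0, r ≤ s → s ≤ t → (s - r : ℝ) < δ →
      ‖f r s‖ ≤ ε * (s - r)) :
    Tendsto (fun n => ∑ k ∈ Finset.range n, f (gridPoint t n k) (gridPoint t n (k + 1))) atTop
      (𝓝 0) := by
  rw [Metric.tendsto_nhds]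
  intro ε hε
  obtain ⟨δ, hδ, hfδ⟩ := hf (ε / (t + 1)) (by positivity)
  have hmesh := (tendsto_const_div_atTop_nhds_zero_nat (t : ℝ)).eventually_lt_const hδ
  filter_upwards [hmesh, eventually_ne_atTop 0] with n hn hn0
  have hterm : ∀ k ∈ Finset.range n, ‖f (gridPoint t n k) (gridPoint t n (k + 1))‖
      ≤ ε / (t + 1) * (gridPoint t n (k + 1) - gridPoint t n k) := fun k hk =>
    hfδ _ _ (gridPoint_mono t n k.le_succ)
      ((gridPoint_mono t n (Finset.mem_range.1 hk)).trans_eq (gridPoint_self t hn0))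
      (by rwa [coe_gridPoint_succ_sub])
  rw [dist_zero_right]
  calc ‖∑ k ∈ Finset.range n, f (gridPoint t n k) (gridPoint t n (k + 1))‖
      ≤ ε / (t + 1) * t := by
        refine (norm_sum_le_of_le _ hterm).trans_eq ?_
        rw [← Finset.mul_sum, Finset.sum_range_sub (fun k => (gridPoint t n k : ℝ)),
          gridPoint_self t hn0, gridPoint_zero, NNReal.coe_zero, sub_zero]
    _ < ε := by
        rw [div_mul_eq_mul_div, div_lt_iff₀ (by positivity)]
        linarith

variable [NormedSpace ℝ E]

/-- The left Riemann sum of `∫₀ᵗ exp (a s) db(s)` along the regular subdivision of `[0, t]`. -/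
def expWeightedSum (a : ℝ) (t : ℝ≥0) (n : ℕ) (b : ℝ≥0 → E) : E :=
  ∑ k ∈ Finset.range n,
    Real.exp (a * gridPoint t n k) • (b (gridPoint t n (k + 1)) - b (gridPoint t n k))

theorem exists_norm_integral_sub_le {F : ℝ × ℝ → E} (hF : Continuous F) (t : ℝ≥0) {ε : ℝ}
    (hε : 0 < ε) :
    ∃ δ > 0, ∀ r s : ℝ≥0, r ≤ s → s ≤ t → (s - r : ℝ) < δ →
      ‖∫ u in (r : ℝ)..s, (F (u, s) - F (r, u))‖ ≤ ε * (s - r) := by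
  have huc : UniformContinuousOn F (Set.Icc 0 (t : ℝ) ×ˢ Set.Icc 0 (t : ℝ)) :=
    (isCompact_Icc.prod isCompact_Icc).uniformContinuousOn_of_continuous hF.continuousOn
  obtain ⟨δ, hδ, hFδ⟩ := Metric.uniformContinuousOn_iff.1 huc ε hε
  refine ⟨δ, hδ, fun r s hrs hst hsr => ?_⟩
  have hrs' : (r : ℝ) ≤ s := hrs
  have hst' : (s : ℝ) ≤ t := hst
  have hr0 : (0 : ℝ) ≤ r := r.coe_nonneg
  refine (intervalIntegral.norm_integral_le_of_norm_le_const (C := ε) fun u hu => ?_).trans_eq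
    (by rw [abs_of_nonneg (sub_nonneg.2 hrs')])
  rw [Set.uIoc_of_le hrs'] at hu
  rw [← dist_eq_norm]
  refine (hFδ (u, s) ⟨⟨?_, ?_⟩, ?_, hst'⟩ (r, u) ⟨⟨hr0, ?_⟩, ?_, ?_⟩ ?_).le
  case refine_7 =>
    rw [Prod.dist_eq, max_lt_iff, Real.dist_eq, Real.dist_eq, abs_of_nonneg (by linarith [hu.1]),
      abs_of_nonneg (by linarith [hu.2])]
    constructor <;> linarith [hu.1, hu.2]
  all_goals linarith [hu.1, hu.2]

section LinearEquation

variable {a : ℝ} {x b : ℝ≥0 → E} (hx : Continuous x)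
  (hb : ∀ s, x s = x 0 - a • (∫ u in (0 : ℝ)..(s : ℝ), x u.toNNReal) + b s)

include hx hb

theorem sub_eq_sub_add_smul_integral (r s : ℝ≥0) :
    b s - b r = x s - x r + a • ∫ u in (r : ℝ)..s, x u.toNNReal := by
  have hcont : Continuous fun u : ℝ => x u.toNNReal := hx.comp continuous_real_toNNReal
  rw [hb s, hb r, ← intervalIntegral.integral_interval_sub_left
    (hcont.intervalIntegrable 0 s) (hcont.intervalIntegrable 0 r)]
  module

variable [CompleteSpace E]

theorem exp_smul_sub_sub_exp_smul_sub (r s : ℝ≥0) :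
    (Real.exp (a * s) • x s - Real.exp (a * r) • x r) - Real.exp (a * r) • (b s - b r)
      = ∫ u in (r : ℝ)..s,
          ((a * Real.exp (a * u)) • x s - (a * Real.exp (a * r)) • x u.toNNReal) := by
  have : Continuous fun u : ℝ => x u.toNNReal := hx.comp continuous_real_toNNReal
  have hexp : ∫ u in (r : ℝ)..s, a * Real.exp (a * u) = Real.exp (a * s) - Real.exp (a * r) := by
    refine intervalIntegral.integral_eq_sub_of_hasDerivAt (f := fun u => Real.exp (a * u))
      (fun u _ => ?_) (Continuous.intervalIntegrable (by fun_prop) _ _)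
    simpa [mul_comm] using ((hasDerivAt_id u).const_mul a).exp
  rw [intervalIntegral.integral_sub, intervalIntegral.integral_smul_const, hexp,
    intervalIntegral.integral_smul, sub_eq_sub_add_smul_integral hx hb]
  · module
  all_goals exact Continuous.intervalIntegrable (by fun_prop) _ _

theorem tendsto_expWeightedSum (t : ℝ≥0) :
    Tendsto (fun n => expWeightedSum a t n b) atTop (𝓝 (Real.exp (a * t) • x t - x 0)) := by
  have : Continuous fun u : ℝ => x u.toNNReal := hx.comp continuous_real_toNNReal
  have herr := tendsto_sum_gridPoint_zero (t := t)
    (f := fun r s => (Real.exp (a * s) • x s - Real.exp (a * r) • x r)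
      - Real.exp (a * r) • (b s - b r)) fun ε hε => by
    simp_rw [exp_smul_sub_sub_exp_smul_sub hx hb]
    simpa using exists_norm_integral_sub_le
      (F := fun p => (a * Real.exp (a * p.1)) • x p.2.toNNReal) (by fun_prop) t hε
  have hlim := herr.const_sub (Real.exp (a * t) • x t - x 0)
  rw [sub_zero] at hlim
  refine hlim.congr' ?_
  filter_upwards [eventually_ne_atTop 0] with n hn
  rw [Finset.sum_sub_distrib, Finset.sum_range_sub
    (fun k => Real.exp (a * gridPoint t n k) • x (gridPoint t n k)), gridPoint_self t hn]
  simp [expWeightedSum]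

end LinearEquation

theorem tendsto_expWeightedSum_coe {a : ℝ} (ha : a ≠ 0) (t : ℝ≥0) :
    Tendsto (fun n => expWeightedSum a t n ((↑) : ℝ≥0 → ℝ)) atTop
      (𝓝 ((Real.exp (a * t) - 1) / a)) := by
  have hintegral : ∀ s : ℝ≥0, ∫ u in (0 : ℝ)..s, (1 - Real.exp (-a * (u.toNNReal : ℝ))) / a
      = s / a - (1 - Real.exp (-a * s)) / a ^ 2 := fun s => by
    have hder : ∀ u : ℝ, HasDerivAt (fun u => u / a - (1 - Real.exp (-a * u)) / a ^ 2)
        ((1 - Real.exp (-a * u)) / a) u := fun u => by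
      have h := ((hasDerivAt_id u).const_mul (-a)).exp
      convert! ((hasDerivAt_id u).div_const a).sub ((h.const_sub 1).div_const (a ^ 2)) using 1
      simp only [id]
      field_simp
    rw [intervalIntegral.integral_congr (g := fun u => (1 - Real.exp (-a * u)) / a),
      intervalIntegral.integral_eq_sub_of_hasDerivAt (fun u _ => hder u)
        (Continuous.intervalIntegrable (by fun_prop) _ _)]
    · simp
    · intro u hu
      rw [Set.uIcc_of_le s.coe_nonneg] at hu
      simp only [Real.coe_toNNReal u hu.1]
  have h := tendsto_expWeightedSum (a := a) (x := fun s : ℝ≥0 => (1 - Real.exp (-a * s)) / a)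
    (b := ((↑) : ℝ≥0 → ℝ)) (by fun_prop) (fun s => ?_) t
  · convert! h using 2
    rw [smul_eq_mul, mul_div_assoc', mul_sub, ← Real.exp_add]
    simp
  · rw [hintegral]
    simp only [smul_eq_mul, NNReal.coe_zero, mul_zero, Real.exp_zero]
    field_simp
    ring

end ExponentialRiemannSum

section ForwardProcess

section AEMeasurable

variable {E Ω : Type*} [NormedAddCommGroup E] [NormedSpace ℝ E] [SecondCountableTopology E]
  [MeasurableSpace E] [BorelSpace E] [MeasurableSpace Ω] {μ : Measure Ω}

theorem measurable_expWeightedSum (a : ℝ) (t : ℝ≥0) (n : ℕ) :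
    Measurable (expWeightedSum a t n : (ℝ≥0 → E) → E) := by
  unfold expWeightedSum
  fun_prop

theorem aemeasurable_expWeightedSum {b : ℝ≥0 → Ω → E} (hb : ∀ s, AEMeasurable (b s) μ) (a : ℝ)
    (t : ℝ≥0) (n : ℕ) : AEMeasurable (fun ω => expWeightedSum a t n (b · ω)) μ := by
  unfold expWeightedSum
  fun_prop

end AEMeasurable

theorem tendsto_charFun_map_of_ae_tendsto {E Ω : Type*} [NormedAddCommGroup E]
    [InnerProductSpace ℝ E] [FiniteDimensional ℝ E] [MeasurableSpace E] [BorelSpace E]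
    [MeasurableSpace Ω] {μ : Measure Ω} [IsProbabilityMeasure μ] {Y : ℕ → Ω → E} {Z : Ω → E}
    (hY : ∀ n, AEMeasurable (Y n) μ) (hZ : AEMeasurable Z μ)
    (h : ∀ᵐ ω ∂μ, Tendsto (fun n => Y n ω) atTop (𝓝 (Z ω))) (ξ : E) :
    Tendsto (fun n => charFun (μ.map (Y n)) ξ) atTop (𝓝 (charFun (μ.map Z) ξ)) :=
  ProbabilityMeasure.tendsto_iff_tendsto_charFun.1
    (tendstoInDistribution_of_ae_tendsto hY hZ h).tendsto ξ

variable {Ω : Type*} [MeasurableSpace Ω] {μ : Measure Ω}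

theorem IsBrownianMotion.aemeasurable {d : ℕ} {B : ℝ≥0 → Ω → Rd d} (hB : IsBrownianMotion B μ)
    (s : ℝ≥0) : AEMeasurable (B s) μ :=
  (WithLp.measurable_toLp 2 (Fin d → ℝ)).comp_aemeasurable
    (aemeasurable_pi_lambda _ fun i => (hB.coord i).aemeasurable s)

theorem charFun_map_smul_sub_of_isPreBrownianReal {b : ℝ≥0 → Ω → ℝ} (hb : IsPreBrownianReal b μ)
    {r s : ℝ≥0} (hrs : r ≤ s) (c ξ : ℝ) :
    charFun (μ.map fun ω => c • (b s ω - b r ω)) ξ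
      = Complex.exp (-(c ^ 2 * (s - r) * ξ ^ 2 / 2 : ℝ)) := by
  have hdist : ((nndist s.1 r.1 : ℝ≥0) : ℝ) = s - r := by
    rw [coe_nndist, Real.dist_eq]
    exact abs_of_nonneg (sub_nonneg.2 (NNReal.coe_le_coe.2 hrs))
  rw [charFun_map_smul_comp ((hb.aemeasurable s).fun_sub (hb.aemeasurable r))]
  refine (congrArg (charFun · (c • ξ)) (hb.hasLaw_sub s r).map_eq).trans ?_
  rw [charFun_gaussianReal, hdist, smul_eq_mul]
  push_cast
  ring_nf

theorem charFun_map_expWeightedSum_of_isPreBrownianReal {b : ℝ≥0 → Ω → ℝ}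
    (hb : IsPreBrownianReal b μ) (a : ℝ) (t : ℝ≥0) (n : ℕ) (ξ : ℝ) :
    charFun (μ.map fun ω => expWeightedSum a t n (b · ω)) ξ
      = Complex.exp (-(expWeightedSum (2 * a) t n (↑) * ξ ^ 2 / 2 : ℝ)) := by
  have hterm : ∀ k, AEMeasurable (fun ω => Real.exp (a * gridPoint t n k)
      • (b (gridPoint t n (k + 1)) ω - b (gridPoint t n k) ω)) μ := fun k =>
    ((hb.aemeasurable _).fun_sub (hb.aemeasurable _)).fun_const_smul _
  have hindep := (hb.hasIndepIncrements.nat (gridPoint_mono t n)).comp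
    (fun k z => Real.exp (a * gridPoint t n k) • z) fun k => by fun_prop
  have hprod := congrFun (iIndepFun.charFun_map_fun_finsetSum_eq_prod (s := Finset.range n)
    (fun k _ => hterm k) (hindep.restrict _)) ξ
  refine hprod.trans ?_
  simp_rw [Finset.prod_apply, charFun_map_smul_sub_of_isPreBrownianReal hb
    (gridPoint_mono t n (Nat.le_succ _)), ← Complex.exp_sum, expWeightedSum, smul_eq_mul,
    ← Real.exp_nat_mul, Nat.cast_ofNat, ← mul_assoc]
  push_cast
  rw [Finset.sum_neg_distrib, Finset.sum_mul, Finset.sum_div]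

theorem IsBrownianMotion.charFun_map_expWeightedSum {d : ℕ} {B : ℝ≥0 → Ω → Rd d}
    [IsProbabilityMeasure μ] (hB : IsBrownianMotion B μ) (a : ℝ) (t : ℝ≥0) (n : ℕ) (ξ : Rd d) :
    charFun (μ.map fun ω => expWeightedSum a t n (B · ω)) ξ
      = Complex.exp (-(expWeightedSum (2 * a) t n (↑) * ‖ξ‖ ^ 2 / 2 : ℝ)) := by
  have hcoord : (fun ω => expWeightedSum a t n (B · ω))
      = fun ω => WithLp.toLp 2 fun i => expWeightedSum a t n (B · ω i) := by
    ext ω i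
    simp [expWeightedSum]
  have hindep := hB.indep.comp (fun _ => expWeightedSum a t n)
    fun _ => measurable_expWeightedSum a t n
  have hprod := (iIndepFun_iff_charFun_pi fun i =>
    aemeasurable_expWeightedSum (hB.coord i).aemeasurable a t n).1 hindep ξ
  rw [hcoord]
  refine hprod.trans ((Finset.prod_congr rfl fun i _ =>
    charFun_map_expWeightedSum_of_isPreBrownianReal (hB.coord i).toIsPreBrownianReal
      a t n (ξ i)).trans ?_)
  rw [← Complex.exp_sum, EuclideanSpace.real_norm_sq_eq]
  push_cast
  rw [Finset.sum_neg_distrib, Finset.mul_sum, Finset.sum_div]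

theorem one_sub_exp_neg_pos {t : ℝ≥0} (ht : 0 < t) : 0 < 1 - Real.exp (-t) := by
  rw [sub_pos, Real.exp_lt_one_iff]
  exact neg_neg_of_pos (by exact_mod_cast ht)

theorem exp_neg_half_sq (t : ℝ) : Real.exp (-t / 2) ^ 2 = Real.exp (-t) := by
  rw [← Real.exp_nat_mul]
  ring_nf

namespace IsForwardProcess

variable {d : ℕ} {P₀ : Measure (Rd d)} {B X : ℝ≥0 → Ω → Rd d}

theorem ae_tendsto_initial_add_expWeightedSum
    (hX : IsForwardProcess (1 : Matrix (Fin d) (Fin d) ℝ) P₀ B X μ) (t : ℝ≥0) :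
    ∀ᵐ ω ∂μ, Tendsto (fun n => X 0 ω + expWeightedSum (1 / 2) t n (B · ω)) atTop
      (𝓝 (Real.exp (1 / 2 * t) • X t ω)) := by
  filter_upwards [hX.continuous_paths, hX.equation] with ω hcont heq
  have h := (tendsto_expWeightedSum (a := 1 / 2) (x := fun s => X s ω) (b := fun s => B s ω) hcont
    (fun s => by
      simpa only [CFC.sqrt_one, map_one, one_apply_eq_self] using heq s) t).const_add (X 0 ω)
  rwa [add_sub_cancel] at h

variable [IsProbabilityMeasure μ]

theorem charFun_map_initial_add_expWeightedSum
    (hX : IsForwardProcess (1 : Matrix (Fin d) (Fin d) ℝ) P₀ B X μ) (t : ℝ≥0) (n : ℕ) (ξ : Rd d) :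
    charFun (μ.map fun ω => X 0 ω + expWeightedSum (1 / 2) t n (B · ω)) ξ
      = charFun P₀ ξ * Complex.exp (-(expWeightedSum 1 t n (↑) * ‖ξ‖ ^ 2 / 2 : ℝ)) := by
  have hindep := hX.indep.comp measurable_id (measurable_expWeightedSum (E := Rd d) (1 / 2) t n)
  have hadd := congrFun (hindep.charFun_map_fun_add_eq_mul (hX.aemeasurable 0)
    (aemeasurable_expWeightedSum hX.brownian.aemeasurable (1 / 2) t n)) ξ
  refine hadd.trans ?_
  have hB := hX.brownian.charFun_map_expWeightedSum (1 / 2) t n ξ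
  rw [mul_one_div_cancel two_ne_zero] at hB
  rw [← hX.initial.map_eq, ← hB]
  rfl

theorem charFun_map_exp_smul
    (hX : IsForwardProcess (1 : Matrix (Fin d) (Fin d) ℝ) P₀ B X μ) (t : ℝ≥0) (ξ : Rd d) :
    charFun (μ.map fun ω => Real.exp (1 / 2 * t) • X t ω) ξ
      = charFun P₀ ξ * Complex.exp (-((Real.exp t - 1) * ‖ξ‖ ^ 2 / 2 : ℝ)) := by
  have hlaw := tendsto_charFun_map_of_ae_tendsto
    (fun n => (hX.aemeasurable 0).fun_add
      (aemeasurable_expWeightedSum hX.brownian.aemeasurable (1 / 2) t n))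
    ((hX.aemeasurable t).const_smul (Real.exp (1 / 2 * t)))
    (hX.ae_tendsto_initial_add_expWeightedSum t) ξ
  simp_rw [hX.charFun_map_initial_add_expWeightedSum t] at hlaw
  have hvar := tendsto_expWeightedSum_coe one_ne_zero t
  rw [one_mul, div_one] at hvar
  have hgauss : Continuous fun v : ℝ => Complex.exp (-(v * ‖ξ‖ ^ 2 / 2 : ℝ)) := by fun_prop
  exact tendsto_nhds_unique hlaw (((hgauss.tendsto _).comp hvar).const_mul _)

theorem map_eq_conv (hX : IsForwardProcess (1 : Matrix (Fin d) (Fin d) ℝ) P₀ B X μ) {t : ℝ≥0}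
    (ht : 0 < t) :
    μ.map (X t)
      = P₀.map (Real.exp (-t / 2) • ·) ∗ gaussianMeasure (Rd d) (1 - Real.exp (-t)) := by
  have := hX.initial.isProbabilityMeasure_iff.1 ‹_›
  have : IsProbabilityMeasure (P₀.map (Real.exp (-t / 2) • ·)) :=
    Measure.isProbabilityMeasure_map (by fun_prop)
  have hv := one_sub_exp_neg_pos ht
  have := isProbabilityMeasure_gaussianMeasure (E := Rd d) hv
  refine Measure.ext_of_charFun (funext fun ξ => ?_)
  have hXt : (fun ω => Real.exp (-t / 2) • Real.exp (1 / 2 * t) • X t ω) = X t := by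
    funext ω
    rw [smul_smul, ← Real.exp_add, show -(t : ℝ) / 2 + 1 / 2 * t = 0 by ring, Real.exp_zero,
      one_smul]
  have hvar : (Real.exp t - 1) * Real.exp (-t / 2) ^ 2 = 1 - Real.exp (-t) := by
    rw [exp_neg_half_sq, sub_mul, ← Real.exp_add, add_neg_cancel, Real.exp_zero, one_mul]
  rw [← hXt, charFun_map_smul_comp ((hX.aemeasurable t).fun_const_smul _), hX.charFun_map_exp_smul,
    charFun_conv, charFun_map_smul, charFun_gaussianMeasure hv, norm_smul, Real.norm_eq_abs,
    abs_of_pos (Real.exp_pos _), mul_pow, ← mul_assoc, hvar]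

end IsForwardProcess

end ForwardProcess

section ForwardDensity

variable {d : ℕ} {P₀ : Measure (Rd d)} {r R : ℝ} {δ t : ℝ≥0}

/-- The density at time `t > 0` of the Ornstein–Uhlenbeck process with initial law `P₀` and
stationary covariance `1`. -/
def forwardDensity (P₀ : Measure (Rd d)) (t : ℝ≥0) : Rd d → ℝ :=
  gaussianSmoothing (P₀.map (Real.exp (-t / 2) • ·)) (1 - Real.exp (-t))

theorem ae_map_smul_iff {E : Type*} [AddCommGroup E] [Module ℝ E] [TopologicalSpace E]
    [ContinuousConstSMul ℝ E] [MeasurableSpace E] [BorelSpace E] {P : Measure E} {c : ℝ}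
    (hc : c ≠ 0) {p : E → Prop} :
    (∀ᵐ y ∂P.map (c • ·), p y) ↔ ∀ᵐ y ∂P, p (c • y) :=
  (Homeomorph.smulOfNeZero c hc).measurableEmbedding.ae_map_iff

theorem ae_map_smul_norm_le (hP : ∀ᵐ y ∂P₀, ‖y‖ ≤ r) {c : ℝ} (hc : 0 < c) :
    ∀ᵐ y ∂P₀.map (c • ·), ‖y‖ ≤ c * r := by
  simpa only [ae_map_smul_iff hc.ne', norm_smul_of_nonneg hc.le, mul_le_mul_iff_right₀ hc] using hP

theorem ae_map_smul_norm_sub_le (hP : ∀ᵐ y ∂P₀, ∀ᵐ y' ∂P₀, ‖y - y'‖ ≤ R) {c : ℝ} (hc : 0 < c) :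
    ∀ᵐ y ∂P₀.map (c • ·), ∀ᵐ y' ∂P₀.map (c • ·), ‖y - y'‖ ≤ c * R := by
  simpa only [ae_map_smul_iff hc.ne', ← smul_sub, norm_smul_of_nonneg hc.le,
    mul_le_mul_iff_right₀ hc] using hP

namespace BoundedSupport

theorem exists_ae_norm_le (h : BoundedSupport P₀ R) : ∃ r, ∀ᵐ y ∂P₀, ‖y‖ ≤ r := by
  obtain ⟨r, hr⟩ := h.1.exists_norm_le
  exact ⟨r, Eventually.mono Measure.support_mem_ae hr⟩

theorem ae_norm_sub_le (h : BoundedSupport P₀ R) : ∀ᵐ y ∂P₀, ∀ᵐ y' ∂P₀, ‖y - y'‖ ≤ R := by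
  filter_upwards [Measure.support_mem_ae] with y hy
  filter_upwards [Measure.support_mem_ae] with y' hy'
  rw [← dist_eq_norm]
  exact (Metric.dist_le_diam_of_mem h.1 hy hy').trans h.2

theorem nonneg (h : BoundedSupport P₀ R) : 0 ≤ R :=
  Metric.diam_nonneg.trans h.2

end BoundedSupport

theorem IsForwardProcess.isSmoothDensity_forwardDensity {Ω : Type*} [MeasurableSpace Ω]
    {μ : Measure Ω} [IsProbabilityMeasure μ] {B X : ℝ≥0 → Ω → Rd d}
    (hX : IsForwardProcess (1 : Matrix (Fin d) (Fin d) ℝ) P₀ B X μ) (hP : ∀ᵐ y ∂P₀, ‖y‖ ≤ r)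
    (ht : 0 < t) : IsSmoothDensity (forwardDensity P₀ t) (μ.map (X t)) := by
  have := hX.initial.isProbabilityMeasure_iff.1 ‹_›
  have := Measure.isProbabilityMeasure_map (μ := P₀) (f := (Real.exp (-t / 2) • ·)) (by fun_prop)
  have hv := one_sub_exp_neg_pos ht
  have hPt := ae_map_smul_norm_le hP (Real.exp_pos (-t / 2))
  exact ⟨contDiff_gaussianSmoothing hv hPt, gaussianSmoothing_pos hv hPt,
    (hX.map_eq_conv ht).trans (conv_gaussianMeasure _ hv)⟩

theorem interpCov_one_sub_exp_smul_one (δ t : ℝ) :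
    interpCov ((1 - Real.exp (-δ)) • (1 : Matrix (Fin d) (Fin d) ℝ)) 1 (t - δ)
      = (1 - Real.exp (-t)) • 1 := by
  have hexp : Real.exp (-(t - δ)) * Real.exp (-δ) = Real.exp (-t) := by
    rw [← Real.exp_add]
    ring_nf
  rw [interpCov, smul_smul, ← add_smul, mul_sub, hexp]
  congr 1
  ring

theorem toEuclideanCLM_inv_smul_one {v : ℝ} (hv : v ≠ 0) :
    Matrix.toEuclideanCLM (𝕜 := ℝ) (v • (1 : Matrix (Fin d) (Fin d) ℝ))⁻¹
      = v⁻¹ • ContinuousLinearMap.id ℝ (Rd d) := by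
  have hinv : (v • (1 : Matrix (Fin d) (Fin d) ℝ))⁻¹ = v⁻¹ • 1 :=
    Matrix.inv_eq_left_inv (by simp [smul_smul, hv])
  rw [hinv, map_smul, map_one]
  rfl

theorem supNorm_le {F : Type*} [NormedAddCommGroup F] {f : Rd d → F} {c : ℝ}
    (h : ∀ x, ‖f x‖ ≤ c) : supNorm f ≤ ENNReal.ofReal c :=
  iSup_le fun x => by
    rw [← ofReal_norm]
    exact ENNReal.ofReal_le_ofReal (h x)

theorem inv_one_sub_exp_mul_le (hδ : 0 < δ) (hδt : δ ≤ t) (hR : 0 ≤ R) :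
    (1 - Real.exp (-t))⁻¹ * (Real.exp (-t / 2) * R)
      ≤ R / (1 - Real.exp (-δ)) * Real.exp (-t / 2) := by
  have hvδ := one_sub_exp_neg_pos hδ
  calc (1 - Real.exp (-t))⁻¹ * (Real.exp (-t / 2) * R)
      ≤ (1 - Real.exp (-δ))⁻¹ * (Real.exp (-t / 2) * R) := by gcongr
    _ = R / (1 - Real.exp (-δ)) * Real.exp (-t / 2) := by ring

variable [IsProbabilityMeasure P₀]

theorem supNorm_gradient_log_forwardDensity_add_le (hP : ∀ᵐ y ∂P₀, ‖y‖ ≤ R) (hR : 0 ≤ R)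
    (hδ : 0 < δ) (hδt : δ ≤ t) :
    supNorm (fun x => gradient (fun y => Real.log (forwardDensity P₀ t y)) x
        + Matrix.toEuclideanCLM (𝕜 := ℝ)
          ((1 - Real.exp (-t)) • (1 : Matrix (Fin d) (Fin d) ℝ))⁻¹ x)
      ≤ ENNReal.ofReal (R / (1 - Real.exp (-δ)) * Real.exp (-t / 2)) := by
  have hv := one_sub_exp_neg_pos (hδ.trans_le hδt)
  have := Measure.isProbabilityMeasure_map (μ := P₀) (f := (Real.exp (-t / 2) • ·)) (by fun_prop)
  refine supNorm_le fun x => ?_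
  rw [toEuclideanCLM_inv_smul_one hv.ne']
  exact (norm_gradient_log_gaussianSmoothing_add_le hv
    (ae_map_smul_norm_le hP (Real.exp_pos _)) x).trans (inv_one_sub_exp_mul_le hδ hδt hR)

theorem supNorm_hessian_log_forwardDensity_add_le (hP : BoundedSupport P₀ R) (hδ : 0 < δ)
    (hδt : δ ≤ t) :
    supNorm (fun x => hessian (fun y => Real.log (forwardDensity P₀ t y)) x
        + Matrix.toEuclideanCLM (𝕜 := ℝ)
          ((1 - Real.exp (-t)) • (1 : Matrix (Fin d) (Fin d) ℝ))⁻¹)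
      ≤ ENNReal.ofReal ((R / (1 - Real.exp (-δ))) ^ 2 * Real.exp (-t)) := by
  have hv := one_sub_exp_neg_pos (hδ.trans_le hδt)
  have := Measure.isProbabilityMeasure_map (μ := P₀) (f := (Real.exp (-t / 2) • ·)) (by fun_prop)
  have hR := hP.nonneg
  obtain ⟨r, hr⟩ := hP.exists_ae_norm_le
  refine supNorm_le fun x => ?_
  rw [toEuclideanCLM_inv_smul_one hv.ne']
  have hexp := Real.exp_pos (-t / 2)
  have hbound := inv_one_sub_exp_mul_le hδ hδt hR
  calc ‖hessian (fun y => Real.log (forwardDensity P₀ t y)) x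
        + (1 - Real.exp (-t))⁻¹ • ContinuousLinearMap.id ℝ (Rd d)‖
      ≤ ((1 - Real.exp (-t))⁻¹ * (Real.exp (-t / 2) * R)) ^ 2 :=
        norm_fderiv_gradient_log_gaussianSmoothing_add_le hv (ae_map_smul_norm_le hr hexp)
          (ae_map_smul_norm_sub_le hP.ae_norm_sub_le hexp) x
    _ ≤ (R / (1 - Real.exp (-δ)) * Real.exp (-t / 2)) ^ 2 := by gcongr
    _ = (R / (1 - Real.exp (-δ))) ^ 2 * Real.exp (-t) := by rw [mul_pow, exp_neg_half_sq]

end ForwardDensity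

end

theorem corollary4 {d : ℕ} {Ω : Type*} [MeasurableSpace Ω] (μ : Measure Ω) [IsProbabilityMeasure μ]
    (P₀ : Measure (Rd d)) [IsProbabilityMeasure P₀] (B X : ℝ≥0 → Ω → Rd d)
    (hX : IsForwardProcess (1 : Matrix (Fin d) (Fin d) ℝ) P₀ B X μ)
    (R : ℝ) (hR : BoundedSupport P₀ R) :
    ∃ p : ℝ≥0 → Rd d → ℝ,
      (∀ t : ℝ≥0, 0 < t → IsSmoothDensity (p t) (μ.map (X t))) ∧
      ∀ (δ : ℝ≥0) (A : Matrix (Fin d) (Fin d) ℝ) (Abar : ℝ≥0 → Matrix (Fin d) (Fin d) ℝ),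
        0 < δ →
        A = (1 - Real.exp (-δ)) • (1 : Matrix (Fin d) (Fin d) ℝ) →
        (∀ t : ℝ≥0, Abar t = interpCov A 1 ((t : ℝ) - δ)) →
        ∀ t : ℝ≥0, δ ≤ t →
          Abar t = (1 - Real.exp (-t)) • (1 : Matrix (Fin d) (Fin d) ℝ) ∧
          supNorm (fun x => hessian (fun y => Real.log (p t y)) x
              + Matrix.toEuclideanCLM (𝕜 := ℝ) (Abar t)⁻¹)
            ≤ ENNReal.ofReal (3 * (R / (1 - Real.exp (-δ))) ^ 2 * Real.exp (-t)) ∧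
          (P₀.support ⊆ Metric.closedBall 0 R →
            supNorm (fun x => gradient (fun y => Real.log (p t y)) x
                + Matrix.toEuclideanCLM (𝕜 := ℝ) (Abar t)⁻¹ x)
              ≤ ENNReal.ofReal (R / (1 - Real.exp (-δ)) * Real.exp (-t / 2))) := by
  obtain ⟨r, hr⟩ := hR.exists_ae_norm_le
  refine ⟨forwardDensity P₀, fun t ht => hX.isSmoothDensity_forwardDensity hr ht,
    fun δ A Abar hδ hA hAbar t hδt => ?_⟩
  have hAt : Abar t = (1 - Real.exp (-t)) • 1 := by
    rw [hAbar, hA, interpCov_one_sub_exp_smul_one]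
  rw [hAt]
  refine ⟨rfl, ?_, fun hball => ?_⟩
  · refine (supNorm_hessian_log_forwardDensity_add_le hR hδ hδt).trans
      (ENNReal.ofReal_le_ofReal ?_)
    rw [mul_assoc]
    exact le_mul_of_one_le_left (by positivity) (by norm_num)
  · have hnorm : ∀ᵐ y ∂P₀, ‖y‖ ≤ R := by
      filter_upwards [Measure.support_mem_ae] with y hy
      exact mem_closedBall_zero_iff.1 (hball hy)
    exact supNorm_gradient_log_forwardDensity_add_le hnorm hR.nonneg hδ hδt
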